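/- Let $k$ be a field of characteristic $p>0$ and let $G$ be a finite $p$-group. A $k$-$G$ algebra is a commutative $k$-algebra $A$ on which $G$ acts by $k$-algebra automorphisms; $A^G$ denotes its ring of invariants. Let $\mathfrak{Ts}$ be the category whose objects are the finitely generated $k$-$G$ algebras $A$ that are trace-surjective, i.e. such that the map $\mathrm{tr}\colon A\to A^G$, $a\mapsto\sum_{g\in G} ga$, is surjective, and whose morphisms are the $G$-equivariant homomorphisms of $k$-algebras. An object $P\in\mathfrak{Ts}$ is called s-projective if for every surjective morphism $f\colon A\to B$ in $\mathfrak{Ts}$ the map $\mathfrak{Ts}(P,A)\to\mathfrak{Ts}(P,B)$, $h\mapsto f\circ h$, is surjective. A $k$-algebra $S$ is called a retract of a $k$-algebra $T$ if there is an injective $k$-algebra homomorphism $\iota\colon S\to T$ and an ideal $I$ of $T$ with $T=\iota(S)\oplus I$. **Theorem.** If $P\in\mathfrak{Ts}$ is s-projective, then both $P$ and $P^G$ are retracts of polynomial rings $k[T_1,\dots,T_n]$ over $k$ (in finitely many variables, whose number may differ for $P$ and $P^G$). -/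

import Mathlib

universe u v

namespace TraceSurjective

/-- The transfer (trace) map `a ↦ ∑ g, g • a` of a `k`-`G` algebra. -/
def transfer (G : Type v) [Group G] [Fintype G] {A : Type u} [CommRing A]
    [MulSemiringAction G A] (a : A) : A :=
  ∑ g : G, g • a

/-- The ring of invariants `A^G`, as a `k`-subalgebra of `A`. -/
abbrev invariants (k : Type u) (G : Type v) [Field k] [Group G] (A : Type u) [CommRing A]
    [Algebra k A] [MulSemiringAction G A] [SMulCommClass G k A] : Subalgebra k A :=
  FixedPoints.subalgebra k A G

/-- `A` is an object of the category `Ts`: a finitely generated commutative `k`-algebra on which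
`G` acts by `k`-algebra automorphisms, with `tr(A) = A^G`. -/
structure IsTs (k : Type u) (G : Type v) [Field k] [Group G] [Fintype G] (A : Type u) [CommRing A]
    [Algebra k A] [MulSemiringAction G A] [SMulCommClass G k A] : Prop where
  finiteType : Algebra.FiniteType k A
  range_transfer : Set.range (transfer G : A → A) = (invariants k G A : Set A)

/-- The morphisms of `Ts`: the `G`-equivariant homomorphisms of `k`-algebras. -/
@[ext]
structure TsHom (k : Type u) (G : Type v) [Field k] [Group G] (A B : Type u)
    [CommRing A] [Algebra k A] [MulSemiringAction G A]
    [CommRing B] [Algebra k B] [MulSemiringAction G B] where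
  toAlgHom : A →ₐ[k] B
  map_smul : ∀ (g : G) (a : A), toAlgHom (g • a) = g • toAlgHom a

/-- Composition of morphisms of `Ts`. -/
def TsHom.comp {k : Type u} {G : Type v} [Field k] [Group G] {A B C : Type u}
    [CommRing A] [Algebra k A] [MulSemiringAction G A]
    [CommRing B] [Algebra k B] [MulSemiringAction G B]
    [CommRing C] [Algebra k C] [MulSemiringAction G C]
    (f : TsHom k G B C) (h : TsHom k G A B) : TsHom k G A C where
  toAlgHom := f.toAlgHom.comp h.toAlgHom
  map_smul g a := by simp [h.map_smul, f.map_smul]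

/-- `P` is s-projective: the functor `Ts(P, -)` turns surjective morphisms of `Ts` into surjective
maps. (A finitely generated `k`-algebra is isomorphic to one in the universe of `k`, so it is no
restriction that the objects of `Ts` live there.) -/
def IsSProjective (k : Type u) (G : Type v) [Field k] [Group G] [Fintype G] (P : Type u)
    [CommRing P] [Algebra k P] [MulSemiringAction G P] : Prop :=
  ∀ (A B : Type u)
    [CommRing A] [Algebra k A] [MulSemiringAction G A] [SMulCommClass G k A]
    [CommRing B] [Algebra k B] [MulSemiringAction G B] [SMulCommClass G k B],
    IsTs k G A → IsTs k G B → ∀ f : TsHom k G A B, Function.Surjective f.toAlgHom →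
      Function.Surjective (fun h : TsHom k G P A => f.comp h)

/-- `S` is a retract of `T`: there is an embedding `S ↪ T` of `k`-algebras and an ideal `I` of `T`
with `T = S ⊕ I` (as `k`-vector spaces). -/
def IsRetract (k : Type u) [Field k] (S T : Type u) [CommRing S] [Algebra k S]
    [CommRing T] [Algebra k T] : Prop :=
  ∃ (ι : S →ₐ[k] T) (I : Ideal T), Function.Injective ι ∧
    IsCompl (LinearMap.range ι.toLinearMap) (I.restrictScalars k)

/-- `S` is a retract of a polynomial ring `k[T_1, …, T_n]` in finitely many variables. -/
def IsRetractOfPolynomialRing (k : Type u) [Field k] (S : Type u) [CommRing S]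
    [Algebra k S] : Prop :=
  ∃ n : ℕ, IsRetract k S (MvPolynomial (Fin n) k)

end TraceSurjective

namespace TraceSurjective

open Polynomial

/-! It suffices to map onto `P`, equivariantly, a trace-surjective polynomial ring whose invariants
are also polynomial: s-projectivity splits the surjection, and the splitting restricts to
invariants.

`exists_weakly_initial` builds a polynomial ring `U` with polynomial invariants that maps to every
trace-surjective algebra, by induction on `|G|`. If `G` is a central extension of `Q` by a group of
order `p` and `A` serves `Q`, take `A[X]` with `g • X = X + d g` for a cocycle `d` with `d z = 1`.
The class of `d ^ p - d` descends to `Q`, where it is a coboundary because `A` has an element of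
trace 1; this gives an invariant `N = X ^ p - X + a`, and the invariants of `A[X]` are the
polynomials in `N` over those of `A`.

Since `G` acts freely on the spectrum of `U`, Galois coordinates exist, and they show that `P` is
generated by the image of `U` and finitely many invariants (`exists_surjective_of_equivariant`). So
`U[T_j]`, with the `T_j` fixed, maps onto `P`; its invariants are those of `U` with the `T_j`
adjoined. -/

/-- `A` is isomorphic to a polynomial ring over `k` in finitely many variables. -/
def IsPolynomialRing (k : Type u) [Field k] (A : Type u) [CommRing A] [Algebra k A] : Prop :=
  ∃ n : ℕ, Nonempty (A ≃ₐ[k] MvPolynomial (Fin n) k)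

/-! ### Invariants and vanishing of first cohomology. -/

section Invariants

variable {k : Type u} [Field k] {A : Type u} [CommRing A] [Algebra k A]

/-- The subalgebra of elements fixed by an action given as a homomorphism into `End A`. -/
def fixedSubalgebra {G : Type v} [Group G] (ρ : G →* (A →ₐ[k] A)) : Subalgebra k A where
  carrier := {a | ∀ g, ρ g a = a}
  mul_mem' ha hb g := by rw [map_mul, ha g, hb g]
  add_mem' ha hb g := by rw [map_add, ha g, hb g]
  algebraMap_mem' r g := AlgHom.commutes _ r

theorem mem_fixedSubalgebra {G : Type v} [Group G] {ρ : G →* (A →ₐ[k] A)} {a : A} :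
    a ∈ fixedSubalgebra ρ ↔ ∀ g, ρ g a = a := Iff.rfl

/-- A `1`-cocycle of `G` with values in a trace-surjective algebra is a coboundary; here the
algebra is acted on by a quotient of `G`, to which the cocycle descends. -/
theorem exists_coboundary {G : Type v} {Q : Type v} [Group G] [Group Q] [Fintype Q]
    (π : G →* Q) (hπ : Function.Surjective π) (ρ : Q →* (A →ₐ[k] A)) (e : A)
    (he : ∑ q, ρ q e = 1) (c : G → A) (hc : ∀ g h, c (g * h) = c g + ρ (π g) (c h))
    (hc' : ∀ g h, π g = π h → c g = c h) :
    ∃ a : A, ∀ g, ρ (π g) a = a - c g := by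
  obtain ⟨s, hs⟩ := hπ.hasRightInverse
  -- Averaging the cocycle against an element of trace 1, as in Hilbert 90.
  refine ⟨∑ q, c (s q) * ρ q e, fun g => ?_⟩
  have h1 : ∀ q, ρ (π g) (c (s q) * ρ q e) =
      c (s (π g * q)) * ρ (π g * q) e - c g * ρ (π g * q) e := by
    intro q
    have : c (s (π g * q)) = c g + ρ (π g) (c (s q)) := by
      rw [← hc]
      apply hc'
      rw [hs, map_mul, hs]
    rw [this, map_mul, map_mul ρ, AlgHom.mul_apply]
    ring
  rw [map_sum, Finset.sum_congr rfl fun q _ => h1 q, Finset.sum_sub_distrib,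
    ← Finset.mul_sum]
  have h2 := Equiv.sum_comp (Equiv.mulLeft (π g)) (fun q => ρ q e)
  have h3 := Equiv.sum_comp (Equiv.mulLeft (π g)) (fun q => c (s q) * ρ q e)
  simp only [Equiv.coe_mulLeft] at h2 h3
  rw [h2, he, mul_one, h3]

end Invariants

/-! ### Central extensions by a group of order `p`. -/

section Group

/-- `z` is a central element of order `p` and `Q` is the quotient by its powers. `ψ`, in general not
a homomorphism, is the exponent of `z` relative to a chosen coset representative. -/
theorem exists_central_quotient (p : ℕ) [Fact p.Prime] (G : Type v) [Group G] [Fintype G]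
    [Nontrivial G] (hG : IsPGroup p G) :
    ∃ (Q : Type v) (_ : Group Q) (_ : Fintype Q) (π : G →* Q) (z : G) (ψ : G → ZMod p),
      IsPGroup p Q ∧ Fintype.card Q < Fintype.card G ∧ Function.Surjective π ∧
      (∀ g, z * g = g * z) ∧ π z = 1 ∧ (∀ g, ψ (z * g) = ψ g + 1) ∧
      Function.Bijective fun g => (π g, ψ g) := by
  classical
  have hp : p.Prime := Fact.out
  have := hG.center_nontrivial
  have hdvd : p ∣ Nat.card (Subgroup.center G) := by
    obtain ⟨n, hn⟩ := IsPGroup.iff_card.mp (hG.to_subgroup (Subgroup.center G))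
    have : 1 < Nat.card (Subgroup.center G) := Finite.one_lt_card
    rw [hn] at this ⊢
    exact dvd_pow_self p (by rintro rfl; simp at this)
  obtain ⟨⟨z, hzc⟩, hz⟩ := exists_prime_orderOf_dvd_card' p hdvd
  rw [← Subgroup.orderOf_coe] at hz
  change orderOf z = p at hz
  have hcomm : ∀ g, z * g = g * z := fun g => (Subgroup.mem_center_iff.mp hzc g).symm
  have hN : (Subgroup.zpowers z).Normal := by
    refine ⟨fun n hn g => ?_⟩
    obtain ⟨i, rfl⟩ := Subgroup.mem_zpowers_iff.mp hn
    have : Commute z g := hcomm g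
    rw [← (this.zpow_left i).eq, mul_inv_cancel_right]
    exact hn
  have hex : ∀ g : G, ∃ i : ZMod p,
      g = (QuotientGroup.mk g : G ⧸ Subgroup.zpowers z).out * z ^ i.val := by
    intro g
    have h1 : ((QuotientGroup.mk g : G ⧸ Subgroup.zpowers z).out)⁻¹ * g ∈ Subgroup.zpowers z := by
      rw [← QuotientGroup.eq, QuotientGroup.out_eq']
    rw [(isOfFinOrder_of_finite z).mem_zpowers_iff_mem_range_orderOf] at h1
    obtain ⟨i, hi, hi'⟩ := Finset.mem_image.mp h1
    rw [hz, Finset.mem_range] at hi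
    refine ⟨i, ?_⟩
    rw [ZMod.val_natCast_of_lt hi]
    rw [hi', mul_inv_cancel_left]
  choose ψ hψ using hex
  have hz1 : (QuotientGroup.mk z : G ⧸ Subgroup.zpowers z) = 1 :=
    (QuotientGroup.eq_one_iff z).mpr (Subgroup.mem_zpowers z)
  have key : ∀ (g : G) (n : ℕ), g = (QuotientGroup.mk g : G ⧸ Subgroup.zpowers z).out * z ^ n →
      ψ g = n := by
    intro g n h
    have h2 := (hψ g).symm.trans h
    have h3 := mul_left_cancel h2
    rw [pow_eq_pow_iff_modEq, hz, ← ZMod.natCast_eq_natCast_iff, ZMod.natCast_zmod_val] at h3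
    exact h3
  refine ⟨G ⧸ Subgroup.zpowers z, inferInstance, inferInstance, QuotientGroup.mk' _, z, ψ,
    hG.to_quotient _, ?_, QuotientGroup.mk'_surjective _, hcomm, hz1, ?_, ?_, ?_⟩
  · rw [← Nat.card_eq_fintype_card, ← Nat.card_eq_fintype_card,
      Subgroup.card_eq_card_quotient_mul_card_subgroup (Subgroup.zpowers z), Nat.card_zpowers, hz]
    exact lt_mul_of_one_lt_right Nat.card_pos hp.one_lt
  · intro g
    have : (QuotientGroup.mk (z * g) : G ⧸ Subgroup.zpowers z) = QuotientGroup.mk g := by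
      rw [QuotientGroup.mk_mul, hz1, one_mul]
    rw [key (z * g) ((ψ g).val + 1)]
    · push_cast
      rw [ZMod.natCast_zmod_val]
    · rw [this, pow_succ, ← mul_assoc, ← hψ g, hcomm]
  · intro g h hgh
    simp only [Prod.mk.injEq, QuotientGroup.mk'_apply] at hgh
    rw [hψ g, hψ h, hgh.1, hgh.2]
  · rintro ⟨q, i⟩
    have : (QuotientGroup.mk (q.out * z ^ i.val) : G ⧸ Subgroup.zpowers z) = q := by
      rw [QuotientGroup.mk_mul, QuotientGroup.mk_pow, hz1, one_pow, mul_one, QuotientGroup.out_eq']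
    refine ⟨q.out * z ^ i.val, ?_⟩
    simp only [Prod.mk.injEq, QuotientGroup.mk'_apply]
    refine ⟨this, ?_⟩
    rw [key _ i.val (by rw [this]), ZMod.natCast_zmod_val]

end Group

/-! ### Affine actions on `A[X]` and their invariants. -/

section Polynomial

variable {k : Type u} [Field k] {A : Type u} [CommRing A] [Algebra k A]
  {G : Type v} [Group G] (ρ : G →* (A →ₐ[k] A))

/-- The action on `A[X]` extending `ρ` by `g • X = X + d g`, for a `1`-cocycle `d`. -/
noncomputable def affineAction (d : G → A) (hd : ∀ g h, d (g * h) = d g + ρ g (d h)) :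
    G →* (A[X] →ₐ[k] A[X]) where
  toFun g := ((aeval (X + C (d g)) : A[X] →ₐ[A] A[X]).restrictScalars k).comp (mapAlgHom (ρ g))
  map_one' := by
    have h1 : d 1 = 0 := by simpa using hd 1 1
    ext <;> simp [h1]
  map_mul' g h := by
    ext <;> simp [hd, add_assoc]

variable {ρ} {d : G → A} (hd : ∀ g h, d (g * h) = d g + ρ g (d h))

@[simp] theorem affineAction_C (g : G) (a : A) : affineAction ρ d hd g (C a) = C (ρ g a) := by
  simp [affineAction]

@[simp] theorem affineAction_X (g : G) : affineAction ρ d hd g X = X + C (d g) := by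
  simp [affineAction]

theorem affineAction_apply (g : G) (f : A[X]) :
    affineAction ρ d hd g f = (f.map (ρ g : A →+* A)).comp (X + C (d g)) := by
  induction f using Polynomial.induction_on' with
  | add f₁ f₂ h₁ h₂ => simp [h₁, h₂]
  | monomial n a => simp [← C_mul_X_pow_eq_monomial]

/-- Power sums over the prime field vanish for exponents below `p - 1`, so only the term free of `x`
survives. -/
theorem sum_add_pow_pred (p : ℕ) [Fact p.Prime] [CharP A p] (x : A) :
    ∑ i : ZMod p, (x + (ZMod.castHom dvd_rfl A i : A)) ^ (p - 1) = -1 := by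
  have hp : p.Prime := Fact.out
  simp_rw [add_pow]
  rw [Finset.sum_comm]
  have h : ∀ j ∈ Finset.range (p - 1 + 1), ∑ i : ZMod p,
      x ^ j * (ZMod.castHom dvd_rfl A i : A) ^ (p - 1 - j) * ((p - 1).choose j : A) =
      if j = 0 then -1 else 0 := by
    intro j hj
    rw [← Finset.sum_mul, ← Finset.mul_sum]
    simp_rw [← map_pow]
    rw [← map_sum]
    split_ifs with h0
    · subst h0
      have h2 : ∑ i : ZMod p, i ^ (p - 1) = -1 := by
        simp_rw [ZMod.pow_card_sub_one, Finset.sum_boole, Finset.filter_ne']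
        rw [Finset.card_erase_of_mem (Finset.mem_univ _), Finset.card_univ, ZMod.card,
          Nat.cast_sub hp.one_le]
        simp
      simp [h2]
    · rw [FiniteField.sum_pow_lt_card_sub_one]
      · simp
      · rw [ZMod.card]; have := hp.one_lt; omega
  rw [Finset.sum_congr rfl h]
  simp

end Polynomial

section Polynomial

variable {k : Type u} [Field k] {A : Type u} [CommRing A] [Algebra k A]
  {G : Type v} [Group G] {ρ : G →* (A →ₐ[k] A)} {d : G → A}

theorem action_injective (ρ : G →* (A →ₐ[k] A)) (g : G) : Function.Injective (ρ g) := by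
  refine Function.LeftInverse.injective (g := ρ g⁻¹) fun a => ?_
  rw [← AlgHom.mul_apply, ← map_mul, inv_mul_cancel, map_one, AlgHom.one_apply]

theorem coeff_natDegree_pred_comp_X_add_one {R : Type*} [CommRing R] (f : R[X])
    (hf : 0 < f.natDegree) :
    (f.comp (X + C 1)).coeff (f.natDegree - 1) =
      f.coeff (f.natDegree - 1) + f.natDegree * f.leadingCoeff := by
  obtain ⟨n, hn⟩ : ∃ n, f.natDegree = n + 1 := ⟨_, (Nat.succ_pred_eq_of_pos hf).symm⟩
  have h1 : (hasseDeriv n f).natDegree < 2 :=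
    (natDegree_hasseDeriv_le f n).trans_lt (by omega)
  rw [← taylor_apply, taylor_coeff, leadingCoeff, hn, Nat.add_sub_cancel,
    eval_eq_sum_range' h1]
  simp [Finset.sum_range_succ, hasseDeriv_coeff, add_comm 1 n]

theorem fixed_leadingCoeff (hd : ∀ g h, d (g * h) = d g + ρ g (d h)) {f : A[X]}
    (hf : f ∈ fixedSubalgebra (affineAction ρ d hd)) : f.leadingCoeff ∈ fixedSubalgebra ρ := by
  intro g
  have h := congrArg leadingCoeff (hf g)
  rw [affineAction_apply, ← taylor_apply, leadingCoeff_taylor] at h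
  exact (leadingCoeff_map_of_injective (f := (ρ g : A →+* A)) (action_injective ρ g) f).symm.trans h

/-- `z` acts as `X ↦ X + 1`, which changes the coefficient just below the top by the degree times
the leading coefficient. -/
theorem dvd_natDegree_of_fixed (p : ℕ) [CharP A p] [IsDomain A]
    (hd : ∀ g h, d (g * h) = d g + ρ g (d h)) {z : G} (hz : ρ z = 1) (hdz : d z = 1) {f : A[X]}
    (hf : f ∈ fixedSubalgebra (affineAction ρ d hd)) : p ∣ f.natDegree := by
  rcases Nat.eq_zero_or_pos f.natDegree with h0 | h0
  · rw [h0]; exact dvd_zero p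
  have h := hf z
  have h' : f.comp (X + C 1) = f := by
    rw [affineAction_apply, hz, hdz] at h
    have : f.map ((1 : A →ₐ[k] A) : A →+* A) = f := Polynomial.map_id
    rwa [this] at h
  have h2 := coeff_natDegree_pred_comp_X_add_one f h0
  rw [h', left_eq_add, mul_eq_zero, CharP.cast_eq_zero_iff A p] at h2
  refine h2.resolve_right fun h3 => ?_
  rw [leadingCoeff_eq_zero] at h3
  simp [h3] at h0

/-- The invariants of an Artin-Schreier type extension of an action from `A` to `A[X]` form a
polynomial ring over the invariants of `A`. -/
theorem nonempty_fixedSubalgebra_affineAction_equiv (p : ℕ) [Fact p.Prime] [CharP A p] [IsDomain A]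
    (hd : ∀ g h, d (g * h) = d g + ρ g (d h)) {z : G} (hz : ρ z = 1) (hdz : d z = 1) (a : A)
    (ha : ∀ g, ρ g a = a - (d g ^ p - d g)) :
    Nonempty (fixedSubalgebra (affineAction ρ d hd) ≃ₐ[k] (fixedSubalgebra ρ)[X]) := by
  have hp : p.Prime := Fact.out
  -- `g` adds `d g ^ p - d g` to `X ^ p - X`, and `ha` makes `a` cancel it.
  set N : A[X] := X ^ p - X + C a with hN
  have hNdeg : N.natDegree = p := by
    rw [hN]
    compute_degree!
    · simp [hp.one_lt.ne, hp.ne_zero]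
    · exact hp.one_lt.le
  have hNm : N.Monic := by
    rw [Monic, leadingCoeff, hNdeg, hN]
    simp [coeff_X, coeff_C, hp.one_lt.ne, hp.ne_zero]
  have hNfix : N ∈ fixedSubalgebra (affineAction ρ d hd) := by
    intro g
    have : CharP A[X] p := inferInstance
    rw [hN]
    simp only [map_add, map_sub, map_pow, affineAction_X, affineAction_C, ha, add_pow_char]
    ring
  let Φ : (fixedSubalgebra ρ)[X] →ₐ[k] A[X] :=
    ((aeval N : A[X] →ₐ[A] A[X]).restrictScalars k).comp (mapAlgHom (fixedSubalgebra ρ).val)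
  have hΦ : ∀ q, Φ q = (q.map ((fixedSubalgebra ρ).val : fixedSubalgebra ρ →+* A)).comp N :=
    fun q => rfl
  have hΦC : ∀ c, Φ (C c) = C (c : A) := fun c => by simp [hΦ]
  have hΦX : Φ X = N := by simp [hΦ]
  have hinj : Function.Injective Φ := by
    rw [injective_iff_map_eq_zero]
    intro q hq
    rw [hΦ, comp_eq_zero_iff] at hq
    rcases hq with hq | hq
    · exact (Polynomial.map_eq_zero_iff Subtype.val_injective).mp hq
    · have := congrArg natDegree hq.2
      rw [hNdeg, natDegree_C] at this
      exact absurd this hp.ne_zero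
  have hrange : Φ.range = fixedSubalgebra (affineAction ρ d hd) := by
    apply le_antisymm
    · rintro _ ⟨q, rfl⟩
      change Φ q ∈ _
      induction q using Polynomial.induction_on' with
      | add f₁ f₂ h₁ h₂ => rw [map_add]; exact add_mem h₁ h₂
      | monomial n c =>
        rw [← C_mul_X_pow_eq_monomial, map_mul, map_pow, hΦC, hΦX]
        refine mul_mem (fun g => ?_) (pow_mem hNfix n)
        rw [affineAction_C, c.2 g]
    · intro f hf
      induction hn : f.natDegree using Nat.strong_induction_on generalizing f with
      | _ n ih =>
      have hlc := fixed_leadingCoeff hd hf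
      rcases Nat.eq_zero_or_pos n with h0 | h0
      · rw [h0] at hn
        rw [leadingCoeff, hn] at hlc
        rw [eq_C_of_natDegree_eq_zero hn]
        exact ⟨C ⟨_, hlc⟩, hΦC _⟩
      obtain ⟨m, hm⟩ := dvd_natDegree_of_fixed p hd hz hdz hf
      have hf0 : f ≠ 0 := by rintro rfl; simp at hn; omega
      have hlc0 : f.leadingCoeff ≠ 0 := leadingCoeff_ne_zero.mpr hf0
      have hΦm : Φ (C ⟨_, hlc⟩ * X ^ m) = C f.leadingCoeff * N ^ m := by
        rw [map_mul, map_pow, hΦC, hΦX]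
      have hmem : C f.leadingCoeff * N ^ m ∈ fixedSubalgebra (affineAction ρ d hd) :=
        mul_mem (fun g => by rw [affineAction_C, hlc g]) (pow_mem hNfix m)
      have hlc' : (C f.leadingCoeff * N ^ m).leadingCoeff = f.leadingCoeff := by
        rw [leadingCoeff_mul, leadingCoeff_C, (hNm.pow m).leadingCoeff, mul_one]
      have hdeg : (C f.leadingCoeff * N ^ m).natDegree = n := by
        rw [natDegree_C_mul hlc0, hNm.natDegree_pow, hNdeg, ← hn, hm, mul_comm]
      -- Both terms are invariant with the same leading term, so the degree drops.
      have hmemf : f - C f.leadingCoeff * N ^ m ∈ Φ.range := by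
        refine ih _ ?_ (sub_mem hf hmem) rfl
        rw [← hn]
        by_cases h : f - C f.leadingCoeff * N ^ m = 0
        · rw [h, natDegree_zero, hn]
          exact h0
        · refine natDegree_lt_natDegree h (degree_sub_lt_left ?_ hf0 hlc'.symm)
          rw [degree_eq_natDegree hf0, degree_eq_natDegree (mul_ne_zero (C_ne_zero.mpr hlc0)
            (hNm.pow m).ne_zero), hn, hdeg]
      have := add_mem hmemf (⟨_, hΦm⟩ : C f.leadingCoeff * N ^ m ∈ Φ.range)
      rwa [sub_add_cancel] at this
  exact ⟨((AlgEquiv.ofInjective Φ hinj).trans (Subalgebra.equivOfEq _ _ hrange)).symm⟩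

end Polynomial

/-! ### The weakly initial polynomial algebra. -/

section Universal

theorem IsPolynomialRing.of_equiv {k : Type u} [Field k] {A B : Type u} [CommRing A] [Algebra k A]
    [CommRing B] [Algebra k B] (h : IsPolynomialRing k A) (e : B ≃ₐ[k] A) :
    IsPolynomialRing k B := by
  obtain ⟨n, ⟨f⟩⟩ := h
  exact ⟨n, ⟨e.trans f⟩⟩

theorem IsPolynomialRing.polynomial {k : Type u} [Field k] {A : Type u} [CommRing A] [Algebra k A]
    (h : IsPolynomialRing k A) : IsPolynomialRing k A[X] := by
  obtain ⟨n, ⟨f⟩⟩ := h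
  exact ⟨n + 1, ⟨(Polynomial.mapAlgEquiv f).trans (MvPolynomial.finSuccEquiv k n).symm⟩⟩

theorem IsPolynomialRing.isDomain {k : Type u} [Field k] {A : Type u} [CommRing A] [Algebra k A]
    (h : IsPolynomialRing k A) : IsDomain A := by
  obtain ⟨n, ⟨f⟩⟩ := h
  exact f.toMulEquiv.isDomain _

variable {p : ℕ} [Fact p.Prime] {k : Type u} [Field k] {A : Type u} [CommRing A] [Algebra k A]
  [CharP A p] {G Q : Type v} [Group G] [Group Q] {π : G →* Q} {z : G} {ψ : G → ZMod p}

theorem map_pow_mul (hψ : ∀ g, ψ (z * g) = ψ g + 1) (n : ℕ) (g : G) :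
    ψ (z ^ n * g) = ψ g + n := by
  induction n with
  | zero => simp
  | succ n ih => rw [pow_succ', mul_assoc, hψ, ih]; push_cast; ring

theorem eq_pow_mul (hz : π z = 1) (hψ : ∀ g, ψ (z * g) = ψ g + 1)
    (hb : Function.Bijective fun g => (π g, ψ g)) {g h : G} (hgh : π g = π h) :
    h = z ^ (ψ h - ψ g).val * g := by
  apply hb.1
  simp only [map_mul, map_pow, hz, one_pow, one_mul, map_pow_mul hψ, ZMod.natCast_zmod_val,
    add_sub_cancel, hgh]

/-- A central extension of `Q` by `⟨z⟩` admits a cocycle in a trace-surjective `Q`-algebra sending `z` to `1`. -/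
theorem exists_cocycle [Fintype Q] (hz : π z = 1) (hπ : Function.Surjective π)
    (hcomm : ∀ g, z * g = g * z) (hψ : ∀ g, ψ (z * g) = ψ g + 1)
    (hb : Function.Bijective fun g => (π g, ψ g)) (ρ : Q →* (A →ₐ[k] A)) (e : A)
    (he : ∑ q, ρ q e = 1) :
    ∃ d : G → A, (∀ g h, d (g * h) = d g + ρ (π g) (d h)) ∧ d z = 1 := by
  obtain ⟨s, hs⟩ := hπ.hasRightInverse
  let ι : ZMod p →+* A := ZMod.castHom dvd_rfl A
  have hι : ∀ q i, ρ q (ι i) = ι i := fun q i =>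
    RingHom.congr_fun (Subsingleton.elim ((ρ q : A →+* A).comp ι) ι) i
  -- `x` and `y` differ by a power of the central `z`, which shifts both values of `ψ` alike; the
  -- difference is thus a function on `Q`.
  have hδ : ∀ h x y, π x = π y → ψ x - ψ (h⁻¹ * x) = ψ y - ψ (h⁻¹ * y) := by
    intro h x y hxy
    have hc : ∀ n : ℕ, h⁻¹ * (z ^ n * x) = z ^ n * (h⁻¹ * x) := by
      intro n
      have : Commute (z ^ n) h⁻¹ := (show Commute z h⁻¹ from hcomm _).pow_left n
      rw [← mul_assoc, ← this.eq, mul_assoc]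
    rw [eq_pow_mul hz hψ hb hxy, hc, map_pow_mul hψ, map_pow_mul hψ]
    ring
  -- The coboundary of `ψ` takes values in functions on `Q`; weighting by the translates of `e`
  -- carries these equivariantly into `A`.
  refine ⟨fun g => ∑ q, ι (ψ (s q) - ψ (g⁻¹ * s q)) * ρ q e, fun g h => ?_, ?_⟩
  · have h1 : ρ (π g) (∑ q, ι (ψ (s q) - ψ (h⁻¹ * s q)) * ρ q e) =
        ∑ q, ι (ψ (g⁻¹ * s q) - ψ (h⁻¹ * (g⁻¹ * s q))) * ρ q e := by
      rw [map_sum]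
      refine Eq.trans ?_ (Equiv.sum_comp (Equiv.mulLeft (π g)) _)
      refine Finset.sum_congr rfl fun q _ => ?_
      rw [map_mul, hι, Equiv.coe_mulLeft, map_mul ρ, AlgHom.mul_apply,
        hδ h (s q) (g⁻¹ * s (π g * q)) (by simp [hs _])]
    rw [h1, ← Finset.sum_add_distrib]
    refine Finset.sum_congr rfl fun q _ => ?_
    rw [← add_mul, ← map_add, mul_inv_rev, mul_assoc]
    congr 2
    ring
  · have h1 : ∀ x, ψ x - ψ (z⁻¹ * x) = 1 := fun x => by
      rw [sub_eq_iff_eq_add', ← hψ, mul_inv_cancel_left]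
    simp only [h1, map_one, one_mul, he]

theorem cocycle_pow_mul (hz : π z = 1) {ρ : Q →* (A →ₐ[k] A)} {d : G → A}
    (hd : ∀ g h, d (g * h) = d g + ρ (π g) (d h)) (hdz : d z = 1) (n : ℕ) (g : G) :
    d (z ^ n * g) = d g + n := by
  induction n with
  | zero => simp
  | succ n ih =>
    rw [pow_succ', mul_assoc, hd, hdz, hz, map_one, AlgHom.one_apply, ih]
    push_cast
    ring

/-- Along a fibre of `π`, `d` changes by elements of the prime field, which `x ↦ x ^ p - x` kills.
-/
theorem cocycle_artinSchreier_congr (hz : π z = 1) (hψ : ∀ g, ψ (z * g) = ψ g + 1)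
    (hb : Function.Bijective fun g => (π g, ψ g)) {ρ : Q →* (A →ₐ[k] A)} {d : G → A}
    (hd : ∀ g h, d (g * h) = d g + ρ (π g) (d h)) (hdz : d z = 1) {g h : G} (hgh : π g = π h) :
    d g ^ p - d g = d h ^ p - d h := by
  have hn : ∀ n : ℕ, (n : A) ^ p = n := fun n => by
    have := congrArg (ZMod.castHom dvd_rfl A) (ZMod.pow_card (n : ZMod p))
    rwa [map_pow, map_natCast] at this
  rw [eq_pow_mul hz hψ hb hgh, cocycle_pow_mul hz hd hdz, add_pow_char, hn]
  ring

/-- By `sum_add_pow_pred`, the sum over the fibre of `π` at `q` is `ρ q e`; the sign cancels the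
`-1` there. -/
theorem sum_affineAction [Fintype G] [Fintype Q] (hz : π z = 1) (hψ : ∀ g, ψ (z * g) = ψ g + 1)
    (hb : Function.Bijective fun g => (π g, ψ g)) {ρ : Q →* (A →ₐ[k] A)} {d : G → A}
    (hd : ∀ g h, d (g * h) = d g + ρ (π g) (d h)) (hdz : d z = 1) (e : A)
    (he : ∑ q, ρ q e = 1) :
    ∑ g, affineAction (ρ.comp π) d hd g (-(C e * X ^ (p - 1))) = 1 := by
  let E := Equiv.ofBijective _ hb
  have hE : ∀ g, E g = (π g, ψ g) := fun g => rfl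
  have hπE : ∀ x, π (E.symm x) = x.1 := fun x => by
    have := congrArg Prod.fst (E.apply_symm_apply x); rwa [hE] at this
  have hψE : ∀ x, ψ (E.symm x) = x.2 := fun x => by
    have := congrArg Prod.snd (E.apply_symm_apply x); rwa [hE] at this
  have hEz : ∀ q i, d (E.symm (q, i)) = d (E.symm (q, 0)) + ZMod.castHom dvd_rfl A i := by
    intro q i
    rw [eq_pow_mul hz hψ hb (g := E.symm (q, 0)) (h := E.symm (q, i)) (by rw [hπE, hπE]),
      cocycle_pow_mul hz hd hdz, hψE, hψE, sub_zero]
    congr 1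
    rw [← map_natCast (ZMod.castHom dvd_rfl A), ZMod.natCast_zmod_val]
  rw [← Equiv.sum_comp E.symm, Fintype.sum_prod_type]
  have hq : ∀ q, ∑ i, affineAction (ρ.comp π) d hd (E.symm (q, i)) (-(C e * X ^ (p - 1))) =
      C (ρ q e) := by
    intro q
    have h1 : ∀ i : ZMod p, C (ZMod.castHom dvd_rfl A i) = (ZMod.castHom dvd_rfl A[X] i : A[X]) :=
      fun i => RingHom.congr_fun (Subsingleton.elim ((C : A →+* A[X]).comp
        (ZMod.castHom dvd_rfl A)) (ZMod.castHom dvd_rfl A[X])) i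
    have h2 : ∀ i, affineAction (ρ.comp π) d hd (E.symm (q, i)) (-(C e * X ^ (p - 1))) =
        -C (ρ q e) * ((X + C (d (E.symm (q, 0)))) + (ZMod.castHom dvd_rfl A[X] i : A[X])) ^
          (p - 1) := by
      intro i
      rw [map_neg, map_mul, map_pow, affineAction_C, affineAction_X, hEz, MonoidHom.comp_apply,
        hπE, map_add, h1, neg_mul, add_assoc]
    rw [Finset.sum_congr rfl fun i _ => h2 i, ← Finset.mul_sum, sum_add_pow_pred, neg_mul_neg,
      mul_one]
  rw [Finset.sum_congr rfl fun q _ => hq q, ← map_sum, he, map_one]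

theorem fixedSubalgebra_comp {ρ : Q →* (A →ₐ[k] A)} (hπ : Function.Surjective π) :
    fixedSubalgebra (ρ.comp π) = fixedSubalgebra ρ := by
  ext a
  simp only [mem_fixedSubalgebra, MonoidHom.comp_apply, hπ.forall]

/-- Every finite `p`-group acts on some polynomial ring such that the trace is surjective, the
invariants form a polynomial ring, and there is an equivariant map to every trace-surjective
algebra. -/
theorem exists_weakly_initial (p : ℕ) [Fact p.Prime] (k : Type u) [Field k] [CharP k p]
    (G : Type v) [Group G] [Fintype G] (hG : IsPGroup p G) :
    ∃ (U : Type u) (_ : CommRing U) (_ : Algebra k U) (ρ : G →* (U →ₐ[k] U)),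
      (∃ e : U, ∑ g, ρ g e = 1) ∧ IsPolynomialRing k U ∧
      IsPolynomialRing k (fixedSubalgebra ρ) ∧
      ∀ (H : Type v) [Group H] [Fintype H] (θ : H →* G) (B : Type u) [CommRing B] [Algebra k B]
        (τ : H →* (B →ₐ[k] B)) (e : B), ∑ h, τ h e = 1 →
        ∃ φ : U →ₐ[k] B, ∀ h u, φ (ρ (θ h) u) = τ h (φ u) := by
  induction hn : Fintype.card G using Nat.strong_induction_on generalizing G with
  | _ n ih =>
  rcases subsingleton_or_nontrivial G with hG1 | hG1
  · have hk : IsPolynomialRing k k := ⟨0, ⟨(MvPolynomial.isEmptyAlgEquiv k (Fin 0)).symm⟩⟩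
    refine ⟨k, inferInstance, inferInstance, 1, ⟨1, ?_⟩, hk, ?_, ?_⟩
    · rw [Fintype.sum_subsingleton _ (1 : G)]
      simp
    · have : fixedSubalgebra (1 : G →* (k →ₐ[k] k)) = ⊤ := by
        ext a
        simp [mem_fixedSubalgebra]
      exact hk.of_equiv ((Subalgebra.equivOfEq _ _ this).trans Subalgebra.topEquiv)
    · intro H _ _ θ B _ _ τ e _
      exact ⟨Algebra.ofId k B, fun h u => by
        simp [Algebra.ofId_apply, AlgHom.commutes]⟩
  · obtain ⟨Q, _, _, π, z, ψ, hQ, hlt, hπ, hcomm, hz, hψ, hb⟩ := exists_central_quotient p G hG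
    obtain ⟨A, _, _, ρ, ⟨e, he⟩, hA, hAG, hA'⟩ := ih _ (hn ▸ hlt) Q hQ rfl
    have := hA.isDomain
    have : CharP A p := charP_of_injective_algebraMap (algebraMap k A).injective p
    obtain ⟨d, hd, hdz⟩ := exists_cocycle hz hπ hcomm hψ hb ρ e he
    have hρz : (ρ.comp π) z = 1 := by rw [MonoidHom.comp_apply, hz, map_one]
    obtain ⟨a, ha⟩ := exists_coboundary π hπ ρ e he (fun g => d g ^ p - d g)
      (fun g h => by
        simp only [hd, map_sub, map_pow, add_pow_char]
        ring)
      (fun g h hgh => cocycle_artinSchreier_congr hz hψ hb hd hdz hgh)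
    refine ⟨A[X], inferInstance, inferInstance, affineAction (ρ.comp π) d hd,
      ⟨_, sum_affineAction hz hψ hb hd hdz e he⟩, hA.polynomial, ?_, ?_⟩
    · obtain ⟨E⟩ := nonempty_fixedSubalgebra_affineAction_equiv p (ρ := ρ.comp π) hd hρz hdz a ha
      rw [fixedSubalgebra_comp hπ] at E
      exact hAG.polynomial.of_equiv E
    · intro H _ _ θ B _ _ τ b hb'
      -- `B` need not carry an action of `Q`; hence the mapping property is stated for all groups
      -- `H` over the given one.
      obtain ⟨φ, hφ⟩ := hA' H (π.comp θ) B τ b hb'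
      simp only [MonoidHom.comp_apply] at hφ
      obtain ⟨y, hy⟩ := exists_coboundary (MonoidHom.id H) Function.surjective_id τ b hb'
        (fun h => φ (d (θ h))) (fun g h => by simp [hd, hφ]) (fun g h hgh => by
          rw [show g = h from hgh])
      simp only [MonoidHom.id_apply] at hy
      -- The image of `X` must be moved by `h` through adding `φ (d (θ h))`; `-y` does this.
      let Φ : A[X] →ₐ[k] B :=
        { eval₂RingHom (φ : A →+* B) (-y) with
          commutes' := fun r => by simp [Polynomial.algebraMap_apply] }
      have hΦC : ∀ c, Φ (C c) = φ c := fun c => eval₂_C _ _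
      have hΦX : Φ X = -y := eval₂_X _ _
      refine ⟨Φ, fun h u => ?_⟩
      induction u using Polynomial.induction_on' with
      | add f₁ f₂ h₁ h₂ => simp only [map_add, h₁, h₂]
      | monomial n c =>
        simp only [← C_mul_X_pow_eq_monomial, map_mul, map_pow, affineAction_C, affineAction_X,
          map_add, hΦC, hΦX, map_neg, hy, MonoidHom.comp_apply, hφ]
        congr 2
        ring

end Universal

/-! ### Freeness and Galois coordinates. -/

section Galois

variable {p : ℕ} [Fact p.Prime] {A : Type u} [CommRing A] {k : Type u} [Field k] [Algebra k A]
  {G : Type v} [Group G]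

/-- `F` is constant on the right cosets of the powers of `g`, whose size is a positive power of `p`.
-/
theorem sum_eq_zero_of_left_invariant [Fintype G] {M : Type*} [Ring M] (hp : (p : M) = 0)
    (hG : IsPGroup p G) (F : G → M) {g : G} (hg : g ≠ 1) (hF : ∀ x, F (g * x) = F x) :
    ∑ x, F x = 0 := by
  classical
  obtain ⟨T, hT, -⟩ := (Subgroup.zpowers g).exists_isComplement_right 1
  have : Fintype T := Fintype.ofFinite T
  have hF' : ∀ h ∈ Subgroup.zpowers g, ∀ x, F (h * x) = F x := by
    intro h hh x
    rw [(isOfFinOrder_of_finite g).mem_zpowers_iff_mem_range_orderOf] at hh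
    obtain ⟨n, -, rfl⟩ := Finset.mem_image.mp hh
    clear hh
    induction n with
    | zero => simp
    | succ n ih => simpa only [pow_succ', mul_assoc, hF] using ih
  have hTb : Function.Bijective fun x : Subgroup.zpowers g × T => (x.1 : G) * x.2 := hT
  rw [← Equiv.sum_comp (Equiv.ofBijective _ hTb), Fintype.sum_prod_type_right]
  refine Finset.sum_eq_zero fun t _ => ?_
  obtain ⟨n, hn⟩ := IsPGroup.iff_orderOf.mp hG g
  have hn0 : n ≠ 0 := by
    rintro rfl
    exact hg (orderOf_eq_one_iff.mp (by simpa using hn))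
  simp only [Equiv.ofBijective_apply, fun (h : Subgroup.zpowers g) => hF' h h.2 t]
  rw [Finset.sum_const, Finset.card_univ, ← Nat.card_eq_fintype_card, Nat.card_zpowers, hn,
    nsmul_eq_mul, Nat.cast_pow, hp, zero_pow hn0, zero_mul]

/-- A `p`-group acts freely on the spectrum of a trace-surjective algebra. -/
theorem span_sub_action_eq_top [Fintype G] (hp : (p : A) = 0) (hG : IsPGroup p G)
    (τ : G →* (A →ₐ[k] A)) {e : A} (he : ∑ g, τ g e = 1) {g : G} (hg : g ≠ 1) :
    Ideal.span (Set.range fun a => a - τ g a) = ⊤ := by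
  set I := Ideal.span (Set.range fun a => a - τ g a) with hI
  rw [Ideal.eq_top_iff_one, ← Ideal.Quotient.eq_zero_iff_mem, ← he, map_sum]
  -- Modulo `I` the summands at `g * x` and `x` agree, so the trace of `e`, which is 1, vanishes
  -- there.
  refine sum_eq_zero_of_left_invariant (p := p) ?_ hG _ hg fun x => ?_
  · rw [← map_natCast (Ideal.Quotient.mk I), hp, map_zero]
  · rw [eq_comm, Ideal.Quotient.mk_eq_mk_iff_sub_mem, map_mul, AlgHom.mul_apply]
    exact Ideal.subset_span ⟨_, rfl⟩

theorem exists_separating_family [Fintype G] (hp : (p : A) = 0) (hG : IsPGroup p G)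
    (τ : G →* (A →ₐ[k] A)) {e : A} (he : ∑ g, τ g e = 1) {g : G} (hg : g ≠ 1) :
    ∃ (ι : Type u) (_ : Fintype ι) (x y : ι → A),
      ∑ i, x i * y i = 1 ∧ ∑ i, x i * τ g (y i) = 0 := by
  have h := (Ideal.eq_top_iff_one _).mp (span_sub_action_eq_top hp hG τ he hg)
  obtain ⟨c, hc⟩ := Finsupp.mem_ideal_span_range_iff_exists_finsupp.mp h
  have hc' : ∑ a : c.support, c a * (a : A) - ∑ a : c.support, c a * τ g (a : A) = 1 := by
    rw [← Finset.sum_sub_distrib, ← hc, Finsupp.sum,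
      ← Finset.sum_coe_sort c.support fun a => c a * (a - τ g a)]
    exact Finset.sum_congr rfl fun a _ => (mul_sub (c a) (a : A) (τ g a)).symm
  -- The extra pair, with second entry 1, makes the twisted sum vanish and leaves `hc'` as the
  -- untwisted one.
  refine ⟨Option c.support, inferInstance,
    fun i => i.elim (-∑ a : c.support, c a * τ g (a : A)) fun a => c a,
    fun i => i.elim 1 fun a => a, ?_, ?_⟩
  · simp only [Fintype.sum_option, Option.elim]
    linear_combination hc'
  · simp [Fintype.sum_option]

/-- A trace-surjective algebra over a `p`-group admits Galois coordinates. -/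
theorem exists_galois_coordinates [Fintype G] [DecidableEq G] (hp : (p : A) = 0)
    (hG : IsPGroup p G) (τ : G →* (A →ₐ[k] A)) {e : A} (he : ∑ g, τ g e = 1) :
    ∃ (ι : Type u) (_ : Fintype ι) (x y : ι → A),
      ∀ g, ∑ i, x i * τ g (y i) = if g = 1 then 1 else 0 := by
  suffices H : ∀ s : Finset G, 1 ∉ s → ∃ (ι : Type u) (_ : Fintype ι) (x y : ι → A),
      ∑ i, x i * y i = 1 ∧ ∀ g ∈ s, ∑ i, x i * τ g (y i) = 0 by
    obtain ⟨ι, _, x, y, h1, h2⟩ := H (Finset.univ.erase 1) (by simp)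
    refine ⟨ι, inferInstance, x, y, fun g => ?_⟩
    split_ifs with hg
    · simpa [hg] using h1
    · exact h2 g (by simp [hg])
  intro s
  induction s using Finset.induction_on with
  | empty => exact fun _ => ⟨PUnit, inferInstance, 1, 1, by simp, by simp⟩
  | insert g s _ ih =>
    intro hs
    rw [Finset.mem_insert, not_or] at hs
    obtain ⟨ι, _, x, y, h1, h2⟩ := ih hs.2
    obtain ⟨κ, _, x', y', h1', h2'⟩ := exists_separating_family hp hG τ he (Ne.symm hs.1)
    -- Sums for a product family factor, so zeros accumulate and the value 1 persists.
    have key : ∀ f : A →ₐ[k] A, ∑ i : ι × κ, (x i.1 * x' i.2) * f (y i.1 * y' i.2) =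
        (∑ i, x i * f (y i)) * ∑ j, x' j * f (y' j) := by
      intro f
      rw [Finset.sum_mul_sum, Fintype.sum_prod_type]
      refine Finset.sum_congr rfl fun i _ => Finset.sum_congr rfl fun j _ => ?_
      rw [map_mul]
      ring
    refine ⟨ι × κ, inferInstance, fun i => x i.1 * x' i.2, fun i => y i.1 * y' i.2, ?_, ?_⟩
    · have := key (AlgHom.id k A)
      simp only [AlgHom.id_apply] at this
      rw [this, h1, h1', one_mul]
    · intro h hh
      rw [key]
      rcases Finset.mem_insert.mp hh with rfl | hh
      · rw [h2', mul_zero]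
      · rw [h2 h hh, zero_mul]

end Galois

/-! ### Adjoining fixed variables. -/

section MvPolynomial

variable {k : Type u} [Field k] {A : Type u} [CommRing A] [Algebra k A]
  {G : Type v} [Group G]

theorem IsPolynomialRing.mvPolynomial (h : IsPolynomialRing k A) (σ : Type u) [Finite σ] :
    IsPolynomialRing k (MvPolynomial σ A) := by
  obtain ⟨n, ⟨f⟩⟩ := h
  obtain ⟨m, ⟨g⟩⟩ := Finite.exists_equiv_fin (σ ⊕ Fin n)
  exact ⟨m, ⟨((MvPolynomial.mapAlgEquiv σ f).trans (MvPolynomial.sumAlgEquiv k σ (Fin n)).symm).trans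
    (MvPolynomial.renameEquiv k g)⟩⟩

theorem IsPolynomialRing.finiteType (h : IsPolynomialRing k A) : Algebra.FiniteType k A := by
  obtain ⟨n, ⟨f⟩⟩ := h
  exact Algebra.FiniteType.equiv inferInstance f.symm

/-- The coefficientwise action on a polynomial ring. -/
noncomputable def coeffAction (ρ : G →* (A →ₐ[k] A)) (σ : Type u) :
    G →* (MvPolynomial σ A →ₐ[k] MvPolynomial σ A) where
  toFun g := MvPolynomial.mapAlgHom (ρ g)
  map_one' := by
    refine AlgHom.ext fun x => ?_
    rw [map_one]
    exact MvPolynomial.map_id x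
  map_mul' g h := by
    refine AlgHom.ext fun x => ?_
    rw [map_mul]
    exact (MvPolynomial.map_map (ρ h : A →+* A) (ρ g : A →+* A) x).symm

theorem coeffAction_apply (ρ : G →* (A →ₐ[k] A)) (σ : Type u) (g : G) (q : MvPolynomial σ A) :
    coeffAction ρ σ g q = MvPolynomial.map (ρ g : A →+* A) q := rfl

theorem nonempty_fixedSubalgebra_coeffAction_equiv (ρ : G →* (A →ₐ[k] A)) (σ : Type u) :
    Nonempty (fixedSubalgebra (coeffAction ρ σ) ≃ₐ[k] MvPolynomial σ (fixedSubalgebra ρ)) := by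
  let Φ : MvPolynomial σ (fixedSubalgebra ρ) →ₐ[k] MvPolynomial σ A :=
    MvPolynomial.mapAlgHom (fixedSubalgebra ρ).val
  have hinj : Function.Injective Φ := MvPolynomial.map_injective _ Subtype.val_injective
  have hrange : Φ.range = fixedSubalgebra (coeffAction ρ σ) := by
    ext q
    have h1 : q ∈ Φ.range ↔ q ∈ Set.range
        (MvPolynomial.map ((fixedSubalgebra ρ).val : fixedSubalgebra ρ →+* A)) := Iff.rfl
    have h2 : q ∈ Φ.range ↔ ∀ m, q.coeff m ∈ fixedSubalgebra ρ := by
      have h3 : Set.range ((fixedSubalgebra ρ).val : fixedSubalgebra ρ →+* A) =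
          (Subalgebra.toSubmodule (fixedSubalgebra ρ) : Set A) := Subtype.range_val
      rw [h1, MvPolynomial.mem_range_map_iff_coeffs_subset, h3]
      exact MvPolynomial.mem_coeffsIn_iff_coeffs_subset.symm
    rw [h2, mem_fixedSubalgebra]
    simp only [coeffAction_apply, MvPolynomial.ext_iff, MvPolynomial.coeff_map, mem_fixedSubalgebra]
    exact forall_comm
  exact ⟨((AlgEquiv.ofInjective Φ hinj).trans (Subalgebra.equivOfEq _ _ hrange)).symm⟩

end MvPolynomial

/-! ### Retracts from one-sided inverses. -/

section Retract

variable {k : Type u} [Field k]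

theorem isRetract_of_leftInverse {S T : Type u} [CommRing S] [Algebra k S] [CommRing T]
    [Algebra k T] (ι : S →ₐ[k] T) (r : T →ₐ[k] S) (h : Function.LeftInverse r ι) :
    IsRetract k S T := by
  refine ⟨ι, RingHom.ker r, h.injective, ?_⟩
  rw [isCompl_iff, Submodule.disjoint_def, codisjoint_iff, Submodule.eq_top_iff']
  constructor
  · rintro _ ⟨s, rfl⟩ hs
    have : r (ι s) = 0 := hs
    rw [h] at this
    simp [this]
  · intro t
    rw [← add_sub_cancel (ι (r t)) t]
    refine Submodule.add_mem_sup ⟨r t, rfl⟩ ?_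
    change r (t - ι (r t)) = 0
    rw [map_sub, h, sub_self]

theorem IsPolynomialRing.isRetractOfPolynomialRing {S T : Type u} [CommRing S] [Algebra k S]
    [CommRing T] [Algebra k T] (hT : IsPolynomialRing k T) (ι : S →ₐ[k] T) (r : T →ₐ[k] S)
    (h : Function.LeftInverse r ι) : IsRetractOfPolynomialRing k S := by
  obtain ⟨n, ⟨f⟩⟩ := hT
  exact ⟨n, isRetract_of_leftInverse ((f : T →ₐ[k] _).comp ι) (r.comp f.symm)
    fun s => by simp [h s]⟩

end Retract

/-! ### Covering `P` by a polynomial ring and splitting. -/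

section Main

variable {k : Type u} [Field k] {G : Type v} [Group G]

/-- The semiring action underlying a homomorphism into algebra endomorphisms. -/
abbrev semiringActionOfHom {A : Type u} [CommRing A] [Algebra k A] (ρ : G →* (A →ₐ[k] A)) :
    MulSemiringAction G A where
  smul g a := ρ g a
  one_smul a := by change ρ 1 a = a; simp
  mul_smul g h a := by change ρ (g * h) a = ρ g (ρ h a); simp
  smul_zero g := map_zero (ρ g)
  smul_add g := map_add (ρ g)
  smul_one g := map_one (ρ g)
  smul_mul g := map_mul (ρ g)

/-- The homomorphism into algebra endomorphisms underlying a semiring action. -/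
def homOfSemiringAction (k : Type u) [Field k] (G : Type v) [Group G] (A : Type u) [CommRing A]
    [Algebra k A] [MulSemiringAction G A] [SMulCommClass G k A] : G →* (A →ₐ[k] A) where
  toFun g := MulSemiringAction.toAlgHom k A g
  map_one' := by ext; simp
  map_mul' g h := by ext; simp [mul_smul]

/-- The trace is linear over the invariants. -/
theorem isTs_of_sum_smul_eq_one [Fintype G] {A : Type u} [CommRing A] [Algebra k A]
    [MulSemiringAction G A] [SMulCommClass G k A] (hA : Algebra.FiniteType k A) {e : A}
    (he : ∑ g : G, g • e = 1) : IsTs k G A := by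
  refine ⟨hA, Set.Subset.antisymm ?_ fun b hb => ⟨e * b, ?_⟩⟩
  · rintro _ ⟨a, rfl⟩ g
    rw [transfer, Finset.smul_sum]
    simp only [smul_smul]
    exact Equiv.sum_comp (Equiv.mulLeft g) fun h => h • a
  · have hb' : ∀ g : G, g • b = b := hb
    simp only [transfer, smul_mul', hb', ← Finset.sum_mul, he, one_mul]

/-- A finitely generated trace-surjective algebra `P` receiving an equivariant map from a
trace-surjective algebra `U` is a quotient of a polynomial ring over `U`. -/
theorem exists_surjective_of_equivariant {p : ℕ} [Fact p.Prime] [CharP k p] [Fintype G]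
    (hG : IsPGroup p G) {U P : Type u} [CommRing U] [Algebra k U] [CommRing P] [Algebra k P]
    (hP : Algebra.FiniteType k P) (ρ : G →* (U →ₐ[k] U)) (τ : G →* (P →ₐ[k] P)) {e : U}
    (he : ∑ g, ρ g e = 1) (φ : U →ₐ[k] P) (hφ : ∀ g u, φ (ρ g u) = τ g (φ u)) :
    ∃ (σ : Type u) (_ : Finite σ) (Φ : MvPolynomial σ U →ₐ[k] P), Function.Surjective Φ ∧
      ∀ g q, Φ (coeffAction ρ σ g q) = τ g (Φ q) := by
  classical
  have hp : (p : U) = 0 := by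
    rw [← map_natCast (algebraMap k U), CharP.cast_eq_zero, map_zero]
  obtain ⟨ι, _, x, y, hxy⟩ := exists_galois_coordinates hp hG ρ he
  obtain ⟨S, hS⟩ := hP.out
  -- Traces, hence invariant; by the Galois coordinates, the `t (a, i)` with coefficients `φ (x i)`
  -- sum to `a`.
  let t : S × ι → P := fun j => ∑ g, τ g (φ (y j.2) * j.1)
  have ht : ∀ g j, τ g (t j) = t j := by
    intro g j
    simp only [t, map_sum, ← AlgHom.mul_apply, ← map_mul τ]
    exact Equiv.sum_comp (Equiv.mulLeft g) fun h => τ h (φ (y j.2) * j.1)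
  let Φ : MvPolynomial (S × ι) U →ₐ[k] P := MvPolynomial.aevalTower φ t
  have hΦC : ∀ u, Φ (MvPolynomial.C u) = φ u := fun u => MvPolynomial.aevalTower_C _ _ u
  have hΦX : ∀ j, Φ (MvPolynomial.X j) = t j := fun j => MvPolynomial.aevalTower_X _ _ j
  refine ⟨S × ι, inferInstance, Φ, ?_, fun g q => ?_⟩
  · rw [← AlgHom.range_eq_top, ← top_le_iff, ← hS, Algebra.adjoin_le_iff]
    intro a ha
    refine ⟨∑ i, MvPolynomial.C (x i) * MvPolynomial.X (⟨a, ha⟩, i), ?_⟩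
    change Φ _ = a
    simp only [map_sum, map_mul, hΦC, hΦX, t, Finset.mul_sum]
    rw [Finset.sum_comm]
    have : ∀ g, ∑ i, φ (x i) * (τ g (φ (y i)) * τ g a) = if g = 1 then a else 0 := by
      intro g
      simp only [← hφ, ← mul_assoc, ← Finset.sum_mul, ← map_mul, ← map_sum, hxy]
      split_ifs with h
      · simp [h]
      · simp
    simp [this]
  · rw [coeffAction_apply]
    induction q using MvPolynomial.induction_on with
    | C u => rw [MvPolynomial.map_C, hΦC, hΦC]; exact hφ g u
    | add q₁ q₂ h₁ h₂ => simp only [map_add, h₁, h₂]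
    | mul_X q j h => rw [map_mul, map_mul, map_mul, map_mul, h, MvPolynomial.map_X, hΦX, ht]

end Main

end TraceSurjective

theorem theorem0p6 (p : ℕ) [Fact p.Prime] (k : Type u) [Field k] [CharP k p]
    (G : Type v) [Group G] [Fintype G] (hG : IsPGroup p G)
    (P : Type u) [CommRing P] [Algebra k P] [MulSemiringAction G P] [SMulCommClass G k P]
    (hP : TraceSurjective.IsTs k G P) (hproj : TraceSurjective.IsSProjective k G P) :
    TraceSurjective.IsRetractOfPolynomialRing k P ∧
      TraceSurjective.IsRetractOfPolynomialRing k (TraceSurjective.invariants k G P) := by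
  open TraceSurjective in
  obtain ⟨eP, heP⟩ : ∃ e : P, ∑ g : G, g • e = 1 := by
    have h1 : (1 : P) ∈ (invariants k G P : Set P) := one_mem _
    rwa [← hP.range_transfer] at h1
  obtain ⟨U, _, _, ρ, ⟨e, he⟩, hU, hUG, hinit⟩ := exists_weakly_initial p k G hG
  obtain ⟨φ, hφ⟩ := hinit G (MonoidHom.id G) P (homOfSemiringAction k G P) eP heP
  obtain ⟨σ, _, Φ, hΦ, hΦG⟩ := exists_surjective_of_equivariant hG hP.finiteType ρ
    (homOfSemiringAction k G P) he φ hφ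
  have hQ := hU.mvPolynomial σ
  obtain ⟨E⟩ := nonempty_fixedSubalgebra_coeffAction_equiv ρ σ
  have hQG := (hUG.mvPolynomial σ).of_equiv E
  let _ : MulSemiringAction G (MvPolynomial σ U) := semiringActionOfHom (coeffAction ρ σ)
  have hsmul : ∀ (g : G) (q : MvPolynomial σ U), g • q = coeffAction ρ σ g q := fun _ _ => rfl
  have : SMulCommClass G k (MvPolynomial σ U) := ⟨fun g c q => map_smul (coeffAction ρ σ g) c q⟩
  have hQTs : IsTs k G (MvPolynomial σ U) := by
    refine isTs_of_sum_smul_eq_one hQ.finiteType (e := MvPolynomial.C e) ?_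
    simp only [hsmul, coeffAction_apply, MvPolynomial.map_C]
    rw [← map_sum]
    exact congrArg MvPolynomial.C he
  -- Lifting the identity of `P` along `Φ` gives an equivariant section.
  obtain ⟨h, hh⟩ := hproj (MvPolynomial σ U) P hQTs hP ⟨Φ, hΦG⟩ hΦ ⟨AlgHom.id k P, fun _ _ => rfl⟩
  have hsec : Function.LeftInverse Φ h.toAlgHom := fun a =>
    AlgHom.congr_fun (congrArg TsHom.toAlgHom hh) a
  refine ⟨hQ.isRetractOfPolynomialRing h.toAlgHom Φ hsec, ?_⟩
  refine hQG.isRetractOfPolynomialRing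
    ((h.toAlgHom.comp (invariants k G P).val).codRestrict _ fun a g => ?_)
    ((Φ.comp (fixedSubalgebra (coeffAction ρ σ)).val).codRestrict _ fun q g => ?_)
    fun a => Subtype.ext (hsec a)
  · have ha : g • (a : P) = a := a.2 g
    change g • h.toAlgHom a = h.toAlgHom a
    rw [← h.map_smul, ha]
  · have := hΦG g q
    rw [q.2 g] at this
    exact this.symm
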